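/- For real $\nu$ and $x>0$ let $K_\nu(x)=\int_0^\infty e^{-x\cosh u}\cosh(\nu u)\,du$ be the modified Bessel function of the third kind. Let $\lambda,\chi,\psi,\varphi\in\mathbb R$ with $\chi>0,\ \psi\ge 0$ if $\lambda<0$; $\chi>0,\ \psi>0$ if $\lambda=0$; and $\chi\ge 0,\ \psi>0$ if $\lambda>0$. The generalized inverse Gaussian distribution $N^-(\lambda,\chi,\psi)$ is the distribution on $(0,\infty)$ with density $$h(w)=\frac{\chi^{-\lambda}(\sqrt{\chi\psi})^{\lambda}}{2K_\lambda(\sqrt{\chi\psi})}\,w^{\lambda-1}\exp\Bigl(-\tfrac12(\chi w^{-1}+\psi w)\Bigr)\qquad(\chi,\psi>0),$$ where for $\psi=0$ (so $\lambda<0$) $h(w)=\frac{(\chi/2)^{-\lambda}}{\Gamma(-\lambda)}w^{\lambda-1}e^{-\chi/(2w)}$ (inverse gamma), and for $\chi=0$ (so $\lambda>0$) $h(w)=\frac{(\psi/2)^{\lambda}}{\Gamma(\lambda)}w^{\lambda-1}e^{-\psi w/2}$ (gamma). Let the real random variable $\xi$ have the one-dimensional generalized hyperbolic distribution $GH_1(\lambda,\chi,\psi,0,1,\varphi)$,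 i.e. $\xi$ has the same distribution as $W\varphi+\sqrt W Z$ with $W\sim N^-(\lambda,\chi,\psi)$ and $Z\sim\mathcal N(0,1)$ independent. Then $\xi$ has the density $$f(t)=\int_0^\infty \frac{e^{t\varphi}}{\sqrt{2\pi w}}\exp\Bigl(-\frac{t^2}{2w}-\frac{\varphi^2 w}{2}\Bigr)h(w)\,dw$$ (finite for every $t\neq 0$; the value $f(0)$ is immaterial). For $\alpha\in\mathbb R$, a function $g:\mathbb R\to\mathbb R$ is called $\alpha$-decreasing if it is continuous on $(0,\infty)$ and there is $t^*>0$, which may depend on $\alpha$, such that $t\mapsto t^\alpha g(t)$ is strictly decreasing on $(t^*,\infty)$. The density $f$ satisfies: 1. If $\psi>0$, then $f$ is $\alpha$-decreasing for every $\alpha\in\mathbb R$. 2. If $\psi=0$ and $\varphi<0$, then $f$ is $\alpha$-decreasing for every $\alpha\in\mathbb R$. 3. If $\psi=0$ and $\varphi>0$, then $f$ is $\alpha$-decreasing for every $\alpha<1-\lambda$. 4. If $\psi=0$ and $\varphi=0$, then for every $\alpha\in\mathbb R$, $f$ is $\alpha$-decreasing if and only if $\alpha<1-2\lambda$. -/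

import Mathlib

open MeasureTheory ProbabilityTheory Set

noncomputable section

/-- The modified Bessel function of the third kind `K_ν(x)` for real `ν` and `x > 0`, through its
standard integral representation `∫₀^∞ exp(-x cosh u) cosh(νu) du`. -/
def besselK (ν x : ℝ) : ℝ :=
  ∫ u in Ioi (0 : ℝ), Real.exp (-x * Real.cosh u) * Real.cosh (ν * u)

/-- The admissible parameters of the generalized inverse Gaussian and the generalized hyperbolic
distributions. -/
structure GIGParameters (lam χ ψ : ℝ) : Prop where
  of_neg : lam < 0 → 0 < χ ∧ 0 ≤ ψ
  of_zero : lam = 0 → 0 < χ ∧ 0 < ψ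
  of_pos : 0 < lam → 0 ≤ χ ∧ 0 < ψ

/-- The density, at `t > 0`, of the generalized inverse Gaussian distribution `N⁻(lam, χ, ψ)`.
In the limiting cases `ψ = 0` and `χ = 0` it is the inverse gamma density with parameters
`-lam, χ / 2` and the gamma density with shape `lam` and rate `ψ / 2`. -/
def gigDensity (lam χ ψ t : ℝ) : ℝ :=
  if ψ = 0 then
    (χ / 2) ^ (-lam) / Real.Gamma (-lam) * t ^ (lam - 1) * Real.exp (-(χ / 2) * t⁻¹)
  else if χ = 0 then
    (ψ / 2) ^ lam / Real.Gamma lam * t ^ (lam - 1) * Real.exp (-(ψ / 2) * t)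
  else
    χ ^ (-lam) * (Real.sqrt (χ * ψ)) ^ lam / (2 * besselK lam (Real.sqrt (χ * ψ))) *
      t ^ (lam - 1) * Real.exp (-(1 / 2) * (χ * t⁻¹ + ψ * t))

/-- The generalized inverse Gaussian distribution `N⁻(lam, χ, ψ)` on `(0, ∞)`. -/
def gigLaw (lam χ ψ : ℝ) : Measure ℝ :=
  (volume.restrict (Ioi (0 : ℝ))).withDensity fun t => ENNReal.ofReal (gigDensity lam χ ψ t)

/-- The one-dimensional generalized hyperbolic distribution `GH₁(lam, χ, ψ, μ, S, γ)`: the law of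
`μ + W γ + √W √S Z`, where `W ∼ N⁻(lam, χ, ψ)` and `Z ∼ N(0, 1)` are independent. -/
def ghLaw (lam χ ψ μ S γ : ℝ) : Measure ℝ :=
  ((gigLaw lam χ ψ).prod (gaussianReal 0 1)).map fun p =>
    μ + p.1 * γ + Real.sqrt p.1 * (Real.sqrt S * p.2)

/-- The density of `GH₁(lam, χ, ψ, μ, S, γ)`, as the normal mean-variance mixture integral against
the density of the mixing variable `W`. -/
def ghDensity (lam χ ψ μ S γ t : ℝ) : ℝ :=
  ∫ w in Ioi (0 : ℝ),
    Real.exp ((t - μ) * γ / S) / (Real.sqrt (2 * Real.pi) * Real.sqrt S * Real.sqrt w) *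
      Real.exp (-(t - μ) ^ 2 / (2 * w * S) - γ ^ 2 * w / (2 * S)) * gigDensity lam χ ψ w

/-- `f` is `r`-decreasing: it is continuous on `(0, ∞)`, and `t ↦ t ^ r * f t` is strictly
decreasing on `(tstar, ∞)` for some `tstar > 0`. -/
def IsRDecreasing (r : ℝ) (f : ℝ → ℝ) : Prop :=
  ContinuousOn f (Ioi 0) ∧
    ∃ tstar : ℝ, 0 < tstar ∧ StrictAntiOn (fun t : ℝ => t ^ r * f t) (Ioi tstar)

end

open Filter Topology

/-! Write `I_p(s)` for `gigIntegral p b s` with `b = φ² + ψ`. Absorbing the Gaussian factor into the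
mixing density gives `f(t) = D e^{tφ} I_p(t² + χ)` with `p = lam - 1/2` (`exists_ghDensity_eq`).
Since `dI_p/ds = -I_{p-1}/2`, the derivative of `t^α f(t)` has the sign of `(α/t + φ) I_p - t
I_{p-1}`, so everything depends on the ratio `I_{p-1}/I_p` at large `s`.

For `b = β² > 0` and `s = σ²`, the ratio satisfies `σ² I_{p-1}/I_p ≥ σβ + c` eventually, for each `c
< 1/2 - p = 1 - lam` (`eventually_le_gigIntegral_sub_one`). If `φ < β`, the linear term beats every
`α`; if `φ = β`, that is `ψ = 0 < φ`, the constant term decides and gives `α < 1 - lam`.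

For `b = 0`, scaling gives `I_p(s) = s^p I_p(1)`, so `t^α f(t)` is a multiple of `t^α (t² + χ)^(lam
- 1/2)`, whence the exact threshold `1 - 2 lam`. -/

noncomputable section

/-! ### Integrability, differentiation and scaling of the integrals -/

/-- The unnormalised generalized inverse Gaussian density. -/
def gigKernel (p b s w : ℝ) : ℝ :=
  w ^ (p - 1) * Real.exp (-(s / (2 * w)) - b * w / 2)

/-- The normalising integral of `gigKernel`. -/
def gigIntegral (p b s : ℝ) : ℝ :=
  ∫ w in Ioi (0 : ℝ), gigKernel p b s w

lemma gigKernel_pos (p b s : ℝ) {w : ℝ} (hw : 0 < w) : 0 < gigKernel p b s w := by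
  unfold gigKernel
  positivity

lemma measurable_gigKernel (p b s : ℝ) : Measurable (gigKernel p b s) := by
  unfold gigKernel
  fun_prop

lemma gigKernel_sub_one (p b s : ℝ) {w : ℝ} (hw : 0 < w) :
    gigKernel (p - 1) b s w = gigKernel p b s w / w := by
  unfold gigKernel
  rw [Real.rpow_sub_one hw.ne' (p - 1)]
  ring

/-- The substitution `w ↦ 1/w` turns the kernel into a gamma integrand of shape `-p`. -/
lemma integrableOn_gigKernel_zero {p s : ℝ} (hp : p < 0) (hs : 0 < s) :
    IntegrableOn (gigKernel p 0 s) (Ioi 0) := by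
  have h := integrableOn_rpow_mul_exp_neg_mul_rpow (s := -p - 1) (p := 1) (b := s / 2)
    (by linarith) one_pos (by linarith)
  rw [← integrableOn_Ioi_comp_rpow_iff _ (p := -1) (by norm_num)] at h
  refine h.congr_fun (fun w hw => ?_) measurableSet_Ioi
  have hw : 0 < w := hw
  simp only [gigKernel, smul_eq_mul, Real.rpow_neg_one, Real.rpow_one]
  rw [Real.inv_rpow hw.le, ← Real.rpow_neg hw.le, ← mul_assoc, abs_neg, abs_one, one_mul,
    ← Real.rpow_add hw]
  congr 2
  · ring
  · field_simp
    ring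

/-- For `n > p`, the factor `w^n e^{-bw/2}` is bounded by `n! (2/b)^n`; what remains is the kernel
with `b = 0` and exponent `p - n < 0`. -/
lemma integrableOn_gigKernel_of_pos (p : ℝ) {b s : ℝ} (hb : 0 < b) (hs : 0 < s) :
    IntegrableOn (gigKernel p b s) (Ioi 0) := by
  obtain ⟨n, hn⟩ := exists_nat_gt p
  have h := (integrableOn_gigKernel_zero (p := p - n) (sub_neg.2 hn) hs).const_mul
    ((n.factorial : ℝ) * (2 / b) ^ n)
  refine h.mono' (measurable_gigKernel _ _ _).aestronglyMeasurable ?_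
  refine (ae_restrict_iff' measurableSet_Ioi).2 (ae_of_all _ fun w hw => ?_)
  have hw : 0 < w := hw
  rw [Real.norm_of_nonneg (gigKernel_pos _ _ _ hw).le]
  have h1 := Real.pow_div_factorial_le_exp (x := b * w / 2) (by positivity) n
  have h2 : w ^ n * Real.exp (-(b * w / 2)) ≤ (n.factorial : ℝ) * (2 / b) ^ n := by
    rw [div_le_iff₀ (by positivity)] at h1
    rw [Real.exp_neg, ← div_eq_mul_inv, div_le_iff₀ (Real.exp_pos _)]
    calc w ^ n = (2 / b) ^ n * (b * w / 2) ^ n := by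
          rw [← mul_pow]; congr 1; field_simp
      _ ≤ (2 / b) ^ n * (Real.exp (b * w / 2) * n.factorial) := by gcongr
      _ = _ := by ring
  have h3 : gigKernel p b s w
      = w ^ n * Real.exp (-(b * w / 2)) * gigKernel (p - n) 0 s w := by
    unfold gigKernel
    rw [show p - n - 1 = (p - 1) - n by ring, Real.rpow_sub_natCast hw.ne', zero_mul, zero_div,
      sub_zero, sub_eq_add_neg _ (b * w / 2), Real.exp_add]
    field_simp
  rw [h3]
  exact mul_le_mul_of_nonneg_right h2 (gigKernel_pos _ _ _ hw).le

/-- The parameters for which `gigKernel p b s` is integrable on `(0, ∞)` for every `s > 0`. -/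
def GIGIntegrable (p b : ℝ) : Prop := 0 < b ∨ (b = 0 ∧ p < 0)

lemma GIGIntegrable.sub_one {p b : ℝ} (h : GIGIntegrable p b) : GIGIntegrable (p - 1) b :=
  h.imp id fun h => ⟨h.1, by linarith [h.2]⟩

lemma GIGIntegrable.integrableOn {p b : ℝ} (h : GIGIntegrable p b) {s : ℝ} (hs : 0 < s) :
    IntegrableOn (gigKernel p b s) (Ioi 0) := by
  rcases h with hb | ⟨rfl, hp⟩
  · exact integrableOn_gigKernel_of_pos p hb hs
  · exact integrableOn_gigKernel_zero hp hs

lemma gigIntegral_pos {p b s : ℝ} (h : GIGIntegrable p b) (hs : 0 < s) :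
    0 < gigIntegral p b s := by
  unfold gigIntegral
  rw [setIntegral_pos_iff_support_of_nonneg_ae]
  · have : Function.support (gigKernel p b s) ∩ Ioi 0 = Ioi 0 :=
      inter_eq_right.2 fun w hw => (gigKernel_pos p b s hw).ne'
    simp [this]
  · exact (ae_restrict_iff' measurableSet_Ioi).2
      (ae_of_all _ fun w hw => (gigKernel_pos p b s hw).le)
  · exact h.integrableOn hs

lemma hasDerivAt_gigIntegral {p b s : ℝ} (h : GIGIntegrable p b) (hs : 0 < s) :
    HasDerivAt (gigIntegral p b) (-(1 / 2) * gigIntegral (p - 1) b s) s := by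
  -- The kernel decreases in `s`, so its value at `s / 2` dominates on the neighbourhood `(s/2, ∞)`.
  have key := hasDerivAt_integral_of_dominated_loc_of_deriv_le
    (μ := volume.restrict (Ioi (0 : ℝ))) (F := fun s w => gigKernel p b s w)
    (F' := fun s w => -(1 / 2) * gigKernel (p - 1) b s w)
    (x₀ := s) (s := Ioi (s / 2)) (bound := fun w => 1 / 2 * gigKernel (p - 1) b (s / 2) w)
    (Ioi_mem_nhds (by linarith))
    (Eventually.of_forall fun s => (measurable_gigKernel p b s).aestronglyMeasurable)
    (h.integrableOn hs)
    ((measurable_gigKernel (p - 1) b s).const_mul _).aestronglyMeasurable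
    ?_ ((h.sub_one.integrableOn (half_pos hs)).const_mul _) ?_
  · rw [gigIntegral, ← integral_const_mul]
    exact key.2
  · refine (ae_restrict_iff' measurableSet_Ioi).2 (ae_of_all _ fun w hw x hx => ?_)
    have hw : 0 < w := hw
    have hx : s / 2 < x := hx
    rw [norm_mul, Real.norm_of_nonneg (gigKernel_pos _ _ _ hw).le]
    norm_num
    unfold gigKernel
    gcongr
  · refine (ae_restrict_iff' measurableSet_Ioi).2 (ae_of_all _ fun w hw x _ => ?_)
    have hw : 0 < w := hw
    have h1 : HasDerivAt (fun x : ℝ => -(x / (2 * w)) - b * w / 2) (-(1 / (2 * w))) x :=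
      (((hasDerivAt_id x).div_const (2 * w)).neg).sub_const _
    have h2 := (h1.exp).const_mul (w ^ (p - 1))
    refine h2.congr_deriv ?_
    rw [gigKernel_sub_one p b x hw]
    unfold gigKernel
    field_simp

lemma gigIntegral_zero_eq {p s : ℝ} (hs : 0 < s) :
    gigIntegral p 0 s = s ^ p * gigIntegral p 0 1 := by
  have h := integral_comp_mul_left_Ioi (gigKernel p 0 s) 0 hs
  rw [mul_zero, smul_eq_mul, inv_mul_eq_div, eq_div_iff hs.ne'] at h
  unfold gigIntegral
  rw [← h, ← integral_mul_const, ← integral_const_mul]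
  refine setIntegral_congr_fun measurableSet_Ioi fun w hw => ?_
  have hw : 0 < w := hw
  simp only [gigKernel]
  rw [Real.mul_rpow hs.le hw.le, Real.rpow_sub_one hs.ne']
  have : s / (2 * (s * w)) = 1 / (2 * w) := by field_simp
  rw [this]
  field_simp
  simp

/-- Two expressions for the same derivative in `s` are compared: differentiation under the integral
and the power law `gigIntegral_zero_eq`. -/
lemma gigIntegral_zero_sub_one {p s : ℝ} (hp : p < 0) (hs : 0 < s) :
    s * gigIntegral (p - 1) 0 s = -2 * p * gigIntegral p 0 s := by
  have h1 := hasDerivAt_gigIntegral (Or.inr ⟨rfl, hp⟩ : GIGIntegrable p 0) hs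
  have h2 : HasDerivAt (gigIntegral p 0) (p * s ^ (p - 1) * gigIntegral p 0 1) s := by
    refine ((Real.hasDerivAt_rpow_const (Or.inl hs.ne')).mul_const _).congr_of_eventuallyEq ?_
    filter_upwards [Ioi_mem_nhds hs] with x hx using gigIntegral_zero_eq hx
  have h3 := h1.unique h2
  rw [gigIntegral_zero_eq (p := p) hs]
  rw [Real.rpow_sub_one hs.ne'] at h3
  field_simp at h3
  linarith

/-! ### Derivative and boundary behaviour of the kernel -/

lemma hasDerivAt_gigKernel (p b s : ℝ) {w : ℝ} (hw : 0 < w) :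
    HasDerivAt (gigKernel p b s)
      (gigKernel p b s w * ((p - 1) / w + s / (2 * w ^ 2) - b / 2)) w := by
  have h1 : HasDerivAt (fun w : ℝ => w ^ (p - 1)) ((p - 1) * w ^ (p - 1 - 1)) w :=
    Real.hasDerivAt_rpow_const (Or.inl hw.ne')
  have h2 : HasDerivAt (fun w : ℝ => -(s / (2 * w)) - b * w / 2)
      (s / (2 * w ^ 2) - b / 2) w := by
    have h3 : HasDerivAt (fun w : ℝ => s / (2 * w)) (-(s / (2 * w ^ 2))) w := by
      have := (hasDerivAt_const w s).div ((hasDerivAt_id w).const_mul 2) (by simpa using hw.ne')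
      refine this.congr_deriv ?_
      simp only [id]
      field_simp
      ring
    have h4 : HasDerivAt (fun w : ℝ => b * w / 2) (b / 2) w := by
      simpa using ((hasDerivAt_id w).const_mul b).div_const 2
    exact (h3.neg.sub h4).congr_deriv (by ring)
  refine (h1.mul h2.exp).congr_deriv ?_
  rw [Real.rpow_sub_one hw.ne']
  unfold gigKernel
  ring

lemma tendsto_mul_gigKernel_nhdsGT_zero (p : ℝ) {b s : ℝ} (hb : 0 ≤ b) (hs : 0 < s) :
    Tendsto (fun w => w * gigKernel p b s w) (𝓝[>] 0) (𝓝 0) := by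
  have h := (tendsto_rpow_mul_exp_neg_mul_atTop_nhds_zero (-p) (s / 2) (half_pos hs)).comp
    tendsto_inv_nhdsGT_zero
  refine tendsto_of_tendsto_of_tendsto_of_le_of_le' tendsto_const_nhds h ?_ ?_
  · filter_upwards [self_mem_nhdsWithin] with w hw
    exact mul_nonneg (le_of_lt hw) (gigKernel_pos _ _ _ hw).le
  · filter_upwards [self_mem_nhdsWithin] with w hw
    have hw : 0 < w := hw
    simp only [gigKernel, Function.comp]
    rw [Real.inv_rpow hw.le, ← Real.rpow_neg hw.le, neg_neg, Real.rpow_sub_one hw.ne', ← mul_assoc,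
      mul_div_cancel₀ _ hw.ne']
    gcongr
    have : 0 ≤ b * w / 2 := by positivity
    have h2 : s / (2 * w) = s / 2 * w⁻¹ := by field_simp
    rw [h2]
    linarith

lemma tendsto_mul_gigKernel_atTop (p : ℝ) {b s : ℝ} (hb : 0 < b) (hs : 0 ≤ s) :
    Tendsto (fun w => w * gigKernel p b s w) atTop (𝓝 0) := by
  have h := tendsto_rpow_mul_exp_neg_mul_atTop_nhds_zero p (b / 2) (half_pos hb)
  refine tendsto_of_tendsto_of_tendsto_of_le_of_le' tendsto_const_nhds h ?_ ?_
  · filter_upwards [eventually_gt_atTop 0] with w hw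
    exact mul_nonneg (le_of_lt hw) (gigKernel_pos _ _ _ hw).le
  · filter_upwards [eventually_gt_atTop 0] with w hw
    simp only [gigKernel]
    rw [Real.rpow_sub_one hw.ne', ← mul_assoc, mul_div_cancel₀ _ hw.ne']
    gcongr
    have : 0 ≤ s / (2 * w) := by positivity
    linarith

/-- A bounded measurable factor keeps `gigKernel` integrable. -/
lemma integrableOn_gigKernel_mul {p b s C : ℝ} (h : GIGIntegrable p b) (hs : 0 < s) {g : ℝ → ℝ}
    (hg : Measurable g) (hC : ∀ w, 0 < w → |g w| ≤ C) :
    IntegrableOn (fun w => gigKernel p b s w * g w) (Ioi 0) := by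
  refine ((h.integrableOn hs).mul_const C).mono'
    ((measurable_gigKernel p b s).mul hg).aestronglyMeasurable ?_
  refine (ae_restrict_iff' measurableSet_Ioi).2 (ae_of_all _ fun w hw => ?_)
  rw [norm_mul, Real.norm_of_nonneg (gigKernel_pos _ _ _ hw).le]
  exact mul_le_mul_of_nonneg_left (hC w hw) (gigKernel_pos _ _ _ hw).le

lemma sq_mul_gigKernel_sub_one (p b s : ℝ) {w : ℝ} (hw : 0 < w) :
    s * gigKernel (p - 1) b s w = gigKernel p b s w * (s / w) := by
  rw [gigKernel_sub_one p b s hw]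
  ring

/-! ### Asymptotics of the ratio of consecutive integrals -/

/-- The balance weight `σ / (σ + β w)`, equal to `1 / 2` at the mode `σ / β` of the exponential
factor. -/
def balance (σ β w : ℝ) : ℝ := σ / (σ + β * w)

lemma measurable_balance (σ β : ℝ) : Measurable (balance σ β) := by
  unfold balance
  fun_prop

lemma balance_mem {σ β w : ℝ} (hσ : 0 < σ) (hβ : 0 < β) (hw : 0 < w) :
    balance σ β w ∈ Icc 0 1 := by
  have : 0 < β * w := by positivity
  refine ⟨by unfold balance; positivity, ?_⟩
  rw [balance, div_le_one (by positivity)]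
  linarith

lemma abs_balance_term_le {σ β w : ℝ} (p : ℝ) (hσ : 0 < σ) (hβ : 0 < β) (hw : 0 < w) :
    |-2 * p * balance σ β w + 2 * balance σ β w * (1 - balance σ β w)| ≤ 2 * |p| + 2 := by
  obtain ⟨h0, h1⟩ := balance_mem hσ hβ hw
  have h2 : |p * balance σ β w| ≤ |p| := by
    rw [abs_mul, abs_of_nonneg h0]
    exact mul_le_of_le_one_right (abs_nonneg p) h1
  rw [abs_le] at h2 ⊢
  constructor <;> nlinarith

/-- With `ρ = balance σ β` and `k` the kernel, the total derivative of `2 w k ρ` integrates to zero.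
The weight is chosen so that `ρ (σ²/w - β² w) = σ²/w - σβ` exactly, while `w ρ' = -ρ (1 - ρ)`. The
remaining integrand is bounded, and at the mode, where `ρ = 1/2`, its factor is `1/2 - p`. -/
lemma gigIntegral_sub_one_sub {σ β : ℝ} (p : ℝ) (hσ : 0 < σ) (hβ : 0 < β) :
    σ ^ 2 * gigIntegral (p - 1) (β ^ 2) (σ ^ 2) - σ * β * gigIntegral p (β ^ 2) (σ ^ 2) =
      ∫ w in Ioi (0 : ℝ), gigKernel p (β ^ 2) (σ ^ 2) w *
        (-2 * p * balance σ β w + 2 * balance σ β w * (1 - balance σ β w)) := by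
  have hσ2 : 0 < σ ^ 2 := by positivity
  have hβ2 : 0 < β ^ 2 := by positivity
  have hI : ∀ q, GIGIntegrable q (β ^ 2) := fun q => Or.inl hβ2
  have hk0 := (hI p).integrableOn hσ2
  have hk1 := (hI (p - 1)).integrableOn hσ2
  have hkb := integrableOn_gigKernel_mul (hI p) hσ2
    (g := fun w => -2 * p * balance σ β w + 2 * balance σ β w * (1 - balance σ β w))
    (by have := measurable_balance σ β; fun_prop) (fun w => abs_balance_term_le p hσ hβ)
  set F' : ℝ → ℝ := fun w => σ ^ 2 * gigKernel (p - 1) (β ^ 2) (σ ^ 2) w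
    - σ * β * gigKernel p (β ^ 2) (σ ^ 2) w - gigKernel p (β ^ 2) (σ ^ 2) w *
        (-2 * p * balance σ β w + 2 * balance σ β w * (1 - balance σ β w)) with hF'
  have hderiv : ∀ w ∈ Ioi (0 : ℝ), HasDerivAt
      (fun w => w * gigKernel p (β ^ 2) (σ ^ 2) w * (2 * balance σ β w)) (F' w) w := by
    intro w hw
    have hw : 0 < w := hw
    have hpos : 0 < σ + β * w := by positivity
    have hb : HasDerivAt (balance σ β) (-(σ * β) / (σ + β * w) ^ 2) w := by
      have h1 : HasDerivAt (fun w => σ + β * w) β w := by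
        simpa using ((hasDerivAt_id w).const_mul β).const_add σ
      refine ((hasDerivAt_const w σ).div h1 hpos.ne').congr_deriv ?_
      ring
    refine (((hasDerivAt_id w).mul (hasDerivAt_gigKernel p (β ^ 2) (σ ^ 2) hw)).mul
      (hb.const_mul 2)).congr_deriv ?_
    simp only [hF', sq_mul_gigKernel_sub_one p (β ^ 2) (σ ^ 2) hw, balance, id, Pi.mul_apply]
    field_simp
    ring
  have hle : ∀ w, 0 < w → 0 ≤ w * gigKernel p (β ^ 2) (σ ^ 2) w * (2 * balance σ β w) ∧
      w * gigKernel p (β ^ 2) (σ ^ 2) w * (2 * balance σ β w)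
        ≤ 2 * (w * gigKernel p (β ^ 2) (σ ^ 2) w) := by
    intro w hw
    obtain ⟨h0, h1⟩ := balance_mem hσ hβ hw
    have := mul_pos hw (gigKernel_pos p (β ^ 2) (σ ^ 2) hw)
    constructor
    · positivity
    · nlinarith
  have hzero : ContinuousWithinAt
      (fun w => w * gigKernel p (β ^ 2) (σ ^ 2) w * (2 * balance σ β w)) (Ici 0) 0 := by
    rw [← continuousWithinAt_Ioi_iff_Ici, ContinuousWithinAt, zero_mul, zero_mul]
    refine tendsto_of_tendsto_of_tendsto_of_le_of_le' tendsto_const_nhds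
      (by simpa using (tendsto_mul_gigKernel_nhdsGT_zero p hβ2.le hσ2).const_mul 2) ?_ ?_
    · filter_upwards [self_mem_nhdsWithin] with w hw using (hle w hw).1
    · filter_upwards [self_mem_nhdsWithin] with w hw using (hle w hw).2
  have htop : Tendsto
      (fun w => w * gigKernel p (β ^ 2) (σ ^ 2) w * (2 * balance σ β w)) atTop (𝓝 0) := by
    refine tendsto_of_tendsto_of_tendsto_of_le_of_le' tendsto_const_nhds
      (by simpa using (tendsto_mul_gigKernel_atTop p hβ2 hσ2.le).const_mul 2) ?_ ?_
    · filter_upwards [eventually_gt_atTop 0] with w hw using (hle w hw).1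
    · filter_upwards [eventually_gt_atTop 0] with w hw using (hle w hw).2
  have hlin : IntegrableOn (fun w => σ ^ 2 * gigKernel (p - 1) (β ^ 2) (σ ^ 2) w
      - σ * β * gigKernel p (β ^ 2) (σ ^ 2) w) (Ioi 0) :=
    (hk1.const_mul _).sub (hk0.const_mul _)
  have hint : IntegrableOn F' (Ioi 0) := hlin.sub hkb
  have key := integral_Ioi_of_hasDerivAt_of_tendsto hzero hderiv hint htop
  rw [zero_mul, zero_mul, sub_zero, hF', integral_sub hlin hkb,
    integral_sub (hk1.const_mul _) (hk0.const_mul _), integral_const_mul, integral_const_mul,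
    sub_eq_zero] at key
  exact key

lemma abs_gigIntegral_sub_one_sub_le {σ β : ℝ} (p : ℝ) (hσ : 0 < σ) (hβ : 0 < β) :
    |σ ^ 2 * gigIntegral (p - 1) (β ^ 2) (σ ^ 2) - σ * β * gigIntegral p (β ^ 2) (σ ^ 2)| ≤
      (2 * |p| + 2) * gigIntegral p (β ^ 2) (σ ^ 2) := by
  have hI : GIGIntegrable p (β ^ 2) := Or.inl (by positivity)
  rw [gigIntegral_sub_one_sub p hσ hβ, mul_comm (2 * |p| + 2), gigIntegral, ← integral_mul_const,
    ← Real.norm_eq_abs]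
  refine norm_integral_le_of_norm_le ((hI.integrableOn (by positivity)).mul_const _) ?_
  refine (ae_restrict_iff' measurableSet_Ioi).2 (ae_of_all _ fun w hw => ?_)
  rw [norm_mul, Real.norm_of_nonneg (gigKernel_pos _ _ _ hw).le]
  exact mul_le_mul_of_nonneg_left (abs_balance_term_le p hσ hβ hw) (gigKernel_pos _ _ _ hw).le

/-- A pointwise lower bound for the integrand of `gigIntegral_sub_one_sub` by a quadratic
polynomial in `σ² / w`. -/
lemma le_balance_term {σ β w δ : ℝ} (p : ℝ) (hσ : 0 < σ) (hβ : 0 < β) (hw : 0 < w) (hδ : 0 < δ) :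
    1 / 2 - p - δ - (p ^ 2 / (4 * δ) + 1 / 2) * ((σ ^ 2 / w - σ * β) ^ 2 / (σ * β) ^ 2) ≤
      -2 * p * balance σ β w + 2 * balance σ β w * (1 - balance σ β w) := by
  -- In terms of `η` the right side is `1/2 - p - pη - η²/2`; the linear term is absorbed by Young's
  -- inequality with parameter `δ`.
  set η := 2 * balance σ β w - 1 with hη
  have h1 : η ^ 2 ≤ (σ ^ 2 / w - σ * β) ^ 2 / (σ * β) ^ 2 := by
    have hpos : 0 < σ + β * w := by positivity
    have e1 : η = (σ - β * w) / (σ + β * w) := by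
      rw [hη, balance]; field_simp; ring
    have e2 : (σ ^ 2 / w - σ * β) ^ 2 / (σ * β) ^ 2 = ((σ - β * w) / (β * w)) ^ 2 := by
      field_simp
    rw [e1, e2, div_pow, div_pow]
    gcongr
    linarith
  have h2 : p * η ≤ δ + p ^ 2 / (4 * δ) * η ^ 2 := by
    have : δ + p ^ 2 / (4 * δ) * η ^ 2 - p * η = (2 * δ - p * η) ^ 2 / (4 * δ) := by
      field_simp; ring
    have h3 : 0 ≤ (2 * δ - p * η) ^ 2 / (4 * δ) := by positivity
    linarith
  have h3 : (p ^ 2 / (4 * δ) + 1 / 2) * η ^ 2 ≤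
      (p ^ 2 / (4 * δ) + 1 / 2) * ((σ ^ 2 / w - σ * β) ^ 2 / (σ * β) ^ 2) :=
    mul_le_mul_of_nonneg_left h1 (by positivity)
  have h4 : balance σ β w = (1 + η) / 2 := by rw [hη]; ring
  rw [h4]
  nlinarith

/-- Each factor `1/w` lowers the index by one, so the second moment of `σ²/w - σβ` is a combination
of three consecutive integrals. -/
lemma le_gigIntegral_sub_one_sub {σ β δ : ℝ} (p : ℝ) (hσ : 0 < σ) (hβ : 0 < β) (hδ : 0 < δ) :
    (1 / 2 - p - δ) * gigIntegral p (β ^ 2) (σ ^ 2) - (p ^ 2 / (4 * δ) + 1 / 2) / (σ * β) ^ 2 *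
        ((σ ^ 2) ^ 2 * gigIntegral (p - 1 - 1) (β ^ 2) (σ ^ 2)
          - 2 * (σ * β) * (σ ^ 2 * gigIntegral (p - 1) (β ^ 2) (σ ^ 2))
          + (σ * β) ^ 2 * gigIntegral p (β ^ 2) (σ ^ 2)) ≤
      σ ^ 2 * gigIntegral (p - 1) (β ^ 2) (σ ^ 2) - σ * β * gigIntegral p (β ^ 2) (σ ^ 2) := by
  have hσ2 : 0 < σ ^ 2 := by positivity
  have hI : ∀ q, GIGIntegrable q (β ^ 2) := fun q => Or.inl (by positivity)
  have hk0 := (hI p).integrableOn hσ2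
  have hk1 := (hI (p - 1)).integrableOn hσ2
  have hk2 := (hI (p - 1 - 1)).integrableOn hσ2
  have hkb := integrableOn_gigKernel_mul (hI p) hσ2
    (g := fun w => -2 * p * balance σ β w + 2 * balance σ β w * (1 - balance σ β w))
    (by have := measurable_balance σ β; fun_prop) (fun w => abs_balance_term_le p hσ hβ)
  rw [gigIntegral_sub_one_sub p hσ hβ]
  have hlin : IntegrableOn (fun w => (σ ^ 2) ^ 2 * gigKernel (p - 1 - 1) (β ^ 2) (σ ^ 2) w
      - 2 * (σ * β) * (σ ^ 2 * gigKernel (p - 1) (β ^ 2) (σ ^ 2) w)) (Ioi 0) :=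
    (hk2.const_mul _).sub ((hk1.const_mul _).const_mul _)
  have hquad : IntegrableOn (fun w => (σ ^ 2) ^ 2 * gigKernel (p - 1 - 1) (β ^ 2) (σ ^ 2) w
      - 2 * (σ * β) * (σ ^ 2 * gigKernel (p - 1) (β ^ 2) (σ ^ 2) w)
      + (σ * β) ^ 2 * gigKernel p (β ^ 2) (σ ^ 2) w) (Ioi 0) := hlin.add (hk0.const_mul _)
  unfold gigIntegral
  rw [← integral_const_mul, ← integral_const_mul, ← integral_const_mul, ← integral_const_mul,
    ← integral_const_mul, ← integral_sub (hk2.const_mul _) ((hk1.const_mul _).const_mul _),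
    ← integral_add hlin (hk0.const_mul _), ← integral_const_mul,
    ← integral_sub (hk0.const_mul _) (hquad.const_mul _)]
  refine setIntegral_mono_on ((hk0.const_mul _).sub (hquad.const_mul _)) hkb measurableSet_Ioi
    fun w hw => ?_
  have hw : 0 < w := hw
  have := mul_le_mul_of_nonneg_left (le_balance_term p hσ hβ hw hδ)
    (gigKernel_pos p (β ^ 2) (σ ^ 2) hw).le
  refine le_trans (le_of_eq ?_) this
  rw [gigKernel_sub_one (p - 1) _ _ hw, gigKernel_sub_one p _ _ hw]
  field_simp
  ring

/-- The first-order asymptotic lower bound for the ratio of consecutive integrals. -/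
lemma eventually_le_gigIntegral_sub_one {β c : ℝ} (p : ℝ) (hβ : 0 < β) (hc : c < 1 / 2 - p) :
    ∀ᶠ σ in atTop, (σ * β + c) * gigIntegral p (β ^ 2) (σ ^ 2) ≤
      σ ^ 2 * gigIntegral (p - 1) (β ^ 2) (σ ^ 2) := by
  -- Half the gap: one `δ` is lost pointwise in `le_balance_term`, the other pays for the
  -- second-moment error.
  set δ := (1 / 2 - p - c) / 2 with hδ
  have hδ0 : 0 < δ := by rw [hδ]; linarith
  set L := p ^ 2 / (4 * δ) + 1 / 2 with hL
  have hL0 : 0 < L := by positivity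
  set K := 2 * |p| + 2 with hK
  set K' := 2 * |p - 1| + 2 with hK'
  have hK0 : 0 < K := by positivity
  have hK0' : 0 < K' := by positivity
  have hlim : Tendsto (fun σ : ℝ => L * ((K + K') * (σ * β)⁻¹ + K' * K * ((σ * β)⁻¹ * (σ * β)⁻¹)))
      atTop (𝓝 0) := by
    have h1 : Tendsto (fun σ : ℝ => (σ * β)⁻¹) atTop (𝓝 0) :=
      (tendsto_id.atTop_mul_const hβ).inv_tendsto_atTop
    simpa using ((h1.const_mul (K + K')).add ((h1.mul h1).const_mul (K' * K))).const_mul L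
  filter_upwards [hlim.eventually_lt_const hδ0, eventually_gt_atTop 0] with σ hsmall hσ
  have hσ2 : 0 < σ ^ 2 := by positivity
  have hI : ∀ q, GIGIntegrable q (β ^ 2) := fun q => Or.inl (by positivity)
  have hI0 := gigIntegral_pos (hI p) hσ2
  have hI1 := gigIntegral_pos (hI (p - 1)) hσ2
  have h0 := le_gigIntegral_sub_one_sub p hσ hβ hδ0
  have h1 := abs_le.1 (abs_gigIntegral_sub_one_sub_le p hσ hβ)
  have h2 := abs_le.1 (abs_gigIntegral_sub_one_sub_le (p - 1) hσ hβ)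
  rw [← hL] at h0
  rw [← hK] at h1
  rw [← hK'] at h2
  set A := gigIntegral p (β ^ 2) (σ ^ 2)
  set B := σ ^ 2 * gigIntegral (p - 1) (β ^ 2) (σ ^ 2) with hB
  set M := σ * β with hM
  have hM0 : 0 < M := by positivity
  -- The crude two-sided bounds at indices `p` and `p - 1` cancel the `M²` terms, leaving a second
  -- moment of order `M`; division by `M²` then makes it vanish as `σ → ∞`.
  have hquad : (σ ^ 2) ^ 2 * gigIntegral (p - 1 - 1) (β ^ 2) (σ ^ 2) - 2 * M * B + M ^ 2 * A ≤
      (K' * (M + K) + M * K) * A := by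
    have e1 : (σ ^ 2) ^ 2 * gigIntegral (p - 1 - 1) (β ^ 2) (σ ^ 2) ≤ (M + K') * B := by
      have := mul_le_mul_of_nonneg_left h2.2 hσ2.le
      rw [hB]
      nlinarith
    have e2 : K' * B ≤ K' * ((M + K) * A) :=
      mul_le_mul_of_nonneg_left (by linarith [h1.2]) hK0'.le
    have e3 : M * (-(K * A)) ≤ M * (B - M * A) := mul_le_mul_of_nonneg_left h1.1 hM0.le
    nlinarith
  have h3 := mul_le_mul_of_nonneg_left hquad (show 0 ≤ L / M ^ 2 by positivity)
  have h4 : L / M ^ 2 * ((K' * (M + K) + M * K) * A) ≤ δ * A := by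
    have : L / M ^ 2 * ((K' * (M + K) + M * K) * A)
        = L * ((K + K') * M⁻¹ + K' * K * (M⁻¹ * M⁻¹)) * A := by
      field_simp
      ring
    rw [this]
    exact mul_le_mul_of_nonneg_right hsmall.le hI0.le
  have h5 : 1 / 2 - p = c + 2 * δ := by rw [hδ]; ring
  rw [h5] at h0
  nlinarith

/-! ### Normalising constants and the mixture density -/

/-- Positivity needs integrability, since a divergent integral has value `0`. The bound `cosh u ≥
u²/4` yields decay `e^{-u}` at infinity. -/
lemma besselK_pos (ν : ℝ) {x : ℝ} (hx : 0 < x) : 0 < besselK ν x := by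
  have hpos : ∀ u, 0 < Real.exp (-x * Real.cosh u) * Real.cosh (ν * u) := fun u =>
    mul_pos (Real.exp_pos _) (Real.cosh_pos _)
  have hint : IntegrableOn (fun u => Real.exp (-x * Real.cosh u) * Real.cosh (ν * u)) (Ioi 0) := by
    refine integrable_of_isBigO_exp_neg (b := 1) one_pos (by fun_prop) ?_
    refine Asymptotics.IsBigO.of_bound 1 ?_
    filter_upwards [eventually_ge_atTop 0, eventually_ge_atTop (4 * (|ν| + 1) / x)] with u hu hu2
    rw [Real.norm_of_nonneg (hpos u).le, Real.norm_of_nonneg (Real.exp_pos _).le, one_mul]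
    have h1 : Real.cosh (ν * u) ≤ Real.exp (|ν| * u) := by
      rw [← Real.cosh_abs, abs_mul, abs_of_nonneg hu, Real.cosh_eq]
      have : Real.exp (-(|ν| * u)) ≤ Real.exp (|ν| * u) :=
        Real.exp_le_exp.2 (by nlinarith [abs_nonneg ν])
      linarith
    have h2 : u ^ 2 / 4 ≤ Real.cosh u := by
      have h3 := Real.quadratic_le_exp_of_nonneg hu
      rw [Real.cosh_eq]
      have := Real.exp_pos (-u)
      linarith
    have h4 : 4 * (|ν| + 1) ≤ u * x := (div_le_iff₀ hx).1 hu2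
    calc _ ≤ Real.exp (-x * Real.cosh u) * Real.exp (|ν| * u) := by gcongr
      _ = Real.exp (-x * Real.cosh u + |ν| * u) := (Real.exp_add _ _).symm
      _ ≤ _ := Real.exp_le_exp.2 (by nlinarith)
  unfold besselK
  rw [setIntegral_pos_iff_support_of_nonneg_ae (ae_of_all _ fun u => (hpos u).le) hint]
  have : Function.support (fun u => Real.exp (-x * Real.cosh u) * Real.cosh (ν * u)) = univ :=
    eq_univ_of_forall fun u => (hpos u).ne'
  rw [this, univ_inter, Real.volume_Ioi]
  exact ENNReal.zero_lt_top

lemma GIGParameters.nonneg {lam χ ψ : ℝ} (h : GIGParameters lam χ ψ) : 0 ≤ χ ∧ 0 ≤ ψ := by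
  rcases lt_trichotomy lam 0 with hl | hl | hl
  · exact ⟨(h.of_neg hl).1.le, (h.of_neg hl).2⟩
  · exact ⟨(h.of_zero hl).1.le, (h.of_zero hl).2.le⟩
  · exact ⟨(h.of_pos hl).1, (h.of_pos hl).2.le⟩

lemma GIGParameters.neg_of_psi_eq_zero {lam χ ψ : ℝ} (h : GIGParameters lam χ ψ) (hψ : ψ = 0) :
    lam < 0 ∧ 0 < χ := by
  rcases lt_trichotomy lam 0 with hl | hl | hl
  · exact ⟨hl, (h.of_neg hl).1⟩
  · exact absurd hψ (h.of_zero hl).2.ne'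
  · exact absurd hψ (h.of_pos hl).2.ne'

lemma GIGParameters.pos_of_chi_eq_zero {lam χ ψ : ℝ} (h : GIGParameters lam χ ψ) (hχ : χ = 0) :
    0 < lam := by
  rcases lt_trichotomy lam 0 with hl | hl | hl
  · exact absurd hχ (h.of_neg hl).1.ne'
  · exact absurd hχ (h.of_zero hl).1.ne'
  · exact hl

lemma exists_gigDensity_eq {lam χ ψ : ℝ} (h : GIGParameters lam χ ψ) :
    ∃ C, 0 < C ∧ ∀ w, 0 < w → gigDensity lam χ ψ w = C * gigKernel lam ψ χ w := by
  obtain ⟨hχ, hψ⟩ := h.nonneg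
  by_cases hψ0 : ψ = 0
  · obtain ⟨hl, hχ⟩ := h.neg_of_psi_eq_zero hψ0
    refine ⟨(χ / 2) ^ (-lam) / Real.Gamma (-lam), ?_, fun w hw => ?_⟩
    · have := Real.Gamma_pos_of_pos (neg_pos.2 hl)
      positivity
    · rw [gigDensity, if_pos hψ0, hψ0, gigKernel, ← mul_assoc]
      congr 2
      field_simp
      ring
  by_cases hχ0 : χ = 0
  · have hl := h.pos_of_chi_eq_zero hχ0
    have hψ := lt_of_le_of_ne hψ (Ne.symm hψ0)
    refine ⟨(ψ / 2) ^ lam / Real.Gamma lam, ?_, fun w hw => ?_⟩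
    · have := Real.Gamma_pos_of_pos hl
      positivity
    · rw [gigDensity, if_neg hψ0, if_pos hχ0, hχ0, gigKernel, ← mul_assoc]
      congr 2
      ring
  · have hχ := lt_of_le_of_ne hχ (Ne.symm hχ0)
    have hψ := lt_of_le_of_ne hψ (Ne.symm hψ0)
    refine ⟨χ ^ (-lam) * (Real.sqrt (χ * ψ)) ^ lam / (2 * besselK lam (Real.sqrt (χ * ψ))), ?_,
      fun w hw => ?_⟩
    · have := besselK_pos lam (Real.sqrt_pos.2 (mul_pos hχ hψ))
      positivity
    · rw [gigDensity, if_neg hψ0, if_neg hχ0, gigKernel, ← mul_assoc]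
      congr 2
      field_simp
      ring

lemma measurable_gigDensity (lam χ ψ : ℝ) : Measurable (gigDensity lam χ ψ) := by
  unfold gigDensity
  split_ifs <;> fun_prop

/-- The joint density of the mixing variable and the normal mean-variance mixture. -/
def mixtureKernel (lam χ ψ φ w t : ℝ) : ℝ :=
  gaussianPDFReal (w * φ) w.toNNReal t * gigDensity lam χ ψ w

lemma mixtureKernel_eq {lam χ ψ w : ℝ} (φ t : ℝ) (hw : 0 < w) :
    mixtureKernel lam χ ψ φ w t =
      Real.exp ((t - 0) * φ / 1) / (Real.sqrt (2 * Real.pi) * Real.sqrt 1 * Real.sqrt w) *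
      Real.exp (-(t - 0) ^ 2 / (2 * w * 1) - φ ^ 2 * w / (2 * 1)) * gigDensity lam χ ψ w := by
  rw [mixtureKernel, gaussianPDFReal, Real.coe_toNNReal w hw.le, Real.sqrt_one, mul_one, sub_zero,
    div_one, mul_one, mul_one, div_mul_eq_mul_div, ← Real.exp_add,
    Real.sqrt_mul (by positivity) w, inv_mul_eq_div]
  congr 3
  field_simp
  ring

lemma ghDensity_eq_integral_mixtureKernel (lam χ ψ φ t : ℝ) :
    ghDensity lam χ ψ 0 1 φ t = ∫ w in Ioi (0 : ℝ), mixtureKernel lam χ ψ φ w t :=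
  setIntegral_congr_fun measurableSet_Ioi fun _ hw => (mixtureKernel_eq φ t hw).symm

lemma exists_mixtureKernel_eq {lam χ ψ : ℝ} (h : GIGParameters lam χ ψ) (φ : ℝ) :
    ∃ D, 0 < D ∧ ∀ w, 0 < w → ∀ t, mixtureKernel lam χ ψ φ w t =
      D * Real.exp (t * φ) * gigKernel (lam - 1 / 2) (φ ^ 2 + ψ) (t ^ 2 + χ) w := by
  obtain ⟨C, hC, hCe⟩ := exists_gigDensity_eq h
  refine ⟨C / Real.sqrt (2 * Real.pi), by positivity, fun w hw t => ?_⟩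
  rw [mixtureKernel_eq φ t hw, hCe w hw, Real.sqrt_one, mul_one, sub_zero, div_one, mul_one,
    mul_one]
  unfold gigKernel
  have e1 : w ^ (lam - 1 / 2 - 1) = w ^ (lam - 1) / Real.sqrt w := by
    rw [Real.sqrt_eq_rpow, ← Real.rpow_sub hw]
    congr 1
    ring
  have e2 : Real.exp (-((t ^ 2 + χ) / (2 * w)) - (φ ^ 2 + ψ) * w / 2) =
      Real.exp (-t ^ 2 / (2 * w) - φ ^ 2 * w / 2) *
        Real.exp (-(χ / (2 * w)) - ψ * w / 2) := by
    rw [← Real.exp_add]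
    congr 1
    field_simp
    ring
  rw [e1, e2]
  field_simp

/-- The exponential rate vanishes only for `ψ = φ = 0`, and `ψ = 0` forces `lam < 0`. -/
lemma GIGParameters.gigIntegrable {lam χ ψ : ℝ} (h : GIGParameters lam χ ψ) (φ : ℝ) :
    GIGIntegrable (lam - 1 / 2) (φ ^ 2 + ψ) := by
  have hψ := h.nonneg.2
  rcases hψ.eq_or_lt with hψ | hψ
  · rcases eq_or_ne φ 0 with hφ | hφ
    · exact Or.inr ⟨by rw [← hψ, hφ]; ring, by linarith [(h.neg_of_psi_eq_zero hψ.symm).1]⟩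
    · exact Or.inl (by positivity)
  · exact Or.inl (by positivity)

lemma GIGParameters.sq_add_pos {lam χ ψ t : ℝ} (h : GIGParameters lam χ ψ) (ht : t ≠ 0) :
    0 < t ^ 2 + χ := by
  have := h.nonneg.1
  positivity

lemma exists_ghDensity_eq {lam χ ψ : ℝ} (h : GIGParameters lam χ ψ) (φ : ℝ) :
    ∃ D, 0 < D ∧ ∀ t, ghDensity lam χ ψ 0 1 φ t =
      D * Real.exp (t * φ) * gigIntegral (lam - 1 / 2) (φ ^ 2 + ψ) (t ^ 2 + χ) := by
  obtain ⟨D, hD, hDe⟩ := exists_mixtureKernel_eq h φ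
  refine ⟨D, hD, fun t => ?_⟩
  rw [ghDensity_eq_integral_mixtureKernel, gigIntegral, ← integral_const_mul]
  exact setIntegral_congr_fun measurableSet_Ioi fun w hw => hDe w hw t

lemma integrableOn_mixtureKernel {lam χ ψ : ℝ} (h : GIGParameters lam χ ψ) (φ : ℝ) {t : ℝ}
    (ht : t ≠ 0) : IntegrableOn (fun w => mixtureKernel lam χ ψ φ w t) (Ioi 0) := by
  obtain ⟨D, hD, hDe⟩ := exists_mixtureKernel_eq h φ
  have hI : IntegrableOn (fun w => D * Real.exp (t * φ) *
      gigKernel (lam - 1 / 2) (φ ^ 2 + ψ) (t ^ 2 + χ) w) (Ioi 0) :=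
    ((h.gigIntegrable φ).integrableOn (h.sq_add_pos ht)).const_mul _
  exact hI.congr_fun (fun w hw => (hDe w hw t).symm) measurableSet_Ioi

/-! ### The law has the mixture density -/

lemma gaussianReal_preimage_affine (φ : ℝ) {w : ℝ} (hw : 0 < w) {s : Set ℝ}
    (hs : MeasurableSet s) :
    gaussianReal 0 1 {z | 0 + w * φ + Real.sqrt w * (Real.sqrt 1 * z) ∈ s} =
      ∫⁻ t in s, ENNReal.ofReal (gaussianPDFReal (w * φ) w.toNNReal t) := by
  have h : (gaussianReal 0 1).map (fun z => w * φ + Real.sqrt w * z)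
      = gaussianReal (w * φ) w.toNNReal := by
    have : (fun z => w * φ + Real.sqrt w * z) = (w * φ + ·) ∘ (Real.sqrt w * ·) := rfl
    rw [this, ← Measure.map_map (by fun_prop) (by fun_prop), gaussianReal_map_const_mul,
      gaussianReal_map_const_add, mul_zero, zero_add, mul_one]
    congr 1
    ext
    simp [Real.sq_sqrt hw.le, hw.le]
  have hv : w.toNNReal ≠ 0 := (Real.toNNReal_pos.2 hw).ne'
  have h2 := gaussianReal_apply (w * φ) hv s
  rw [← h, Measure.map_apply (by fun_prop) hs] at h2
  simpa [gaussianPDF, preimage] using h2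

/-- Conditionally on `W = w` the variable is `N(wφ, w)`; Tonelli exchanges the integrals over `w`
and `t`. -/
lemma ghLaw_eq_withDensity {lam χ ψ : ℝ} (h : GIGParameters lam χ ψ) (φ : ℝ) :
    ghLaw lam χ ψ 0 1 φ =
      volume.withDensity (fun t => ENNReal.ofReal (ghDensity lam χ ψ 0 1 φ t)) := by
  obtain ⟨C, hC, hCe⟩ := exists_gigDensity_eq h
  have hnn : ∀ w, 0 < w → 0 ≤ gigDensity lam χ ψ w := fun w hw => by
    rw [hCe w hw]
    exact mul_nonneg hC.le (gigKernel_pos _ _ _ hw).le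
  have hgm := measurable_gigDensity lam χ ψ
  have hm : Measurable fun p : ℝ × ℝ => mixtureKernel lam χ ψ φ p.1 p.2 := by
    unfold mixtureKernel
    fun_prop
  have hmap : Measurable fun p : ℝ × ℝ =>
      0 + p.1 * φ + Real.sqrt p.1 * (Real.sqrt 1 * p.2) := by fun_prop
  ext s hs
  have : SFinite (gigLaw lam χ ψ) := by unfold gigLaw; infer_instance
  rw [ghLaw, Measure.map_apply hmap hs, Measure.prod_apply (hmap hs), gigLaw,
    lintegral_withDensity_eq_lintegral_mul _ (by fun_prop)
      (measurable_measure_prodMk_left (hmap hs)), withDensity_apply _ hs]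
  calc _ = ∫⁻ w in Ioi (0 : ℝ), ∫⁻ t in s, ENNReal.ofReal (mixtureKernel lam χ ψ φ w t) := by
        refine setLIntegral_congr_fun measurableSet_Ioi fun w hw => ?_
        have hw : 0 < w := hw
        have e := gaussianReal_preimage_affine φ hw hs
        simp only [Pi.mul_apply, preimage, mem_ofPred_eq] at e ⊢
        rw [e, ← lintegral_const_mul _ (by fun_prop)]
        refine lintegral_congr fun t => ?_
        rw [mixtureKernel, ENNReal.ofReal_mul (gaussianPDFReal_nonneg _ _ _), mul_comm]
    _ = ∫⁻ t in s, ∫⁻ w in Ioi (0 : ℝ), ENNReal.ofReal (mixtureKernel lam χ ψ φ w t) :=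
        lintegral_lintegral_swap hm.ennreal_ofReal.aemeasurable
    _ = _ := by
        refine lintegral_congr_ae (ae_restrict_of_ae ?_)
        -- At `t = 0` with `χ = 0` the mixture integrand may fail to be integrable, so this null
        -- point is dropped.
        filter_upwards [Measure.ae_ne volume (0 : ℝ)] with t ht
        rw [ghDensity_eq_integral_mixtureKernel,
          ofReal_integral_eq_lintegral_ofReal (integrableOn_mixtureKernel h φ ht)]
        refine (ae_restrict_iff' measurableSet_Ioi).2 (ae_of_all _ fun w hw => ?_)
        exact mul_nonneg (gaussianPDFReal_nonneg _ _ _) (hnn w hw)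

/-! ### Eventual monotonicity of the density -/

/-- The logarithmic derivative criterion for `ghDensity` to be `α`-decreasing. -/
lemma isRDecreasing_ghDensity {lam χ ψ φ α : ℝ} (h : GIGParameters lam χ ψ)
    (hev : ∀ᶠ t in atTop, (α / t + φ) * gigIntegral (lam - 1 / 2) (φ ^ 2 + ψ) (t ^ 2 + χ) <
      t * gigIntegral (lam - 1 / 2 - 1) (φ ^ 2 + ψ) (t ^ 2 + χ)) :
    IsRDecreasing α (ghDensity lam χ ψ 0 1 φ) := by
  obtain ⟨D, hD, hDe⟩ := exists_ghDensity_eq h φ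
  have hfun : ghDensity lam χ ψ 0 1 φ = _ := funext hDe
  have hderiv : ∀ t, 0 < t → HasDerivAt (ghDensity lam χ ψ 0 1 φ) (D * Real.exp (t * φ) *
      (φ * gigIntegral (lam - 1 / 2) (φ ^ 2 + ψ) (t ^ 2 + χ) -
        t * gigIntegral (lam - 1 / 2 - 1) (φ ^ 2 + ψ) (t ^ 2 + χ))) t := by
    intro t ht
    have h1 := hasDerivAt_gigIntegral (h.gigIntegrable φ) (h.sq_add_pos ht.ne')
    have h2 : HasDerivAt (fun t : ℝ => t ^ 2 + χ) (2 * t) t := by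
      simpa using (hasDerivAt_pow 2 t).add_const χ
    have h3 : HasDerivAt (fun t : ℝ => D * Real.exp (t * φ)) (D * (Real.exp (t * φ) * φ)) t := by
      simpa using (((hasDerivAt_id t).mul_const φ).exp).const_mul D
    rw [hfun]
    refine (h3.mul (HasDerivAt.comp t h1 h2)).congr_deriv ?_
    simp only [Function.comp]
    ring
  refine ⟨fun t ht => (hderiv t ht).continuousAt.continuousWithinAt, ?_⟩
  obtain ⟨T, hT⟩ := eventually_atTop.1 hev
  have hT0 : 0 < max T 1 := lt_max_of_lt_right one_pos
  have hderiv2 : ∀ t, 0 < t → HasDerivAt (fun t => t ^ α * ghDensity lam χ ψ 0 1 φ t)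
      (t ^ α * (D * Real.exp (t * φ)) *
        ((α / t + φ) * gigIntegral (lam - 1 / 2) (φ ^ 2 + ψ) (t ^ 2 + χ) -
        t * gigIntegral (lam - 1 / 2 - 1) (φ ^ 2 + ψ) (t ^ 2 + χ))) t := by
    intro t ht
    refine ((Real.hasDerivAt_rpow_const (Or.inl ht.ne')).mul (hderiv t ht)).congr_deriv ?_
    rw [hDe, Real.rpow_sub_one ht.ne']
    ring
  refine ⟨max T 1, hT0, strictAntiOn_of_deriv_neg (convex_Ioi _)
    (fun t ht => (hderiv2 t (hT0.trans ht)).continuousAt.continuousWithinAt) fun t ht => ?_⟩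
  rw [interior_Ioi] at ht
  have ht0 : 0 < t := hT0.trans ht
  rw [(hderiv2 t ht0).deriv]
  exact mul_neg_of_pos_of_neg (by positivity)
    (sub_neg.2 (hT t ((le_max_left _ _).trans (le_of_lt ht))))

lemma isRDecreasing_ghDensity_of_sqrt {lam χ ψ φ α : ℝ} (h : GIGParameters lam χ ψ)
    (hb : 0 < φ ^ 2 + ψ) (hlt : φ < Real.sqrt (φ ^ 2 + ψ) ∨
      (φ = Real.sqrt (φ ^ 2 + ψ) ∧ α < 1 - lam)) :
    IsRDecreasing α (ghDensity lam χ ψ 0 1 φ) := by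
  refine isRDecreasing_ghDensity h ?_
  set β := Real.sqrt (φ ^ 2 + ψ) with hβ
  have hβ0 : 0 < β := Real.sqrt_pos.2 hb
  have hβ2 : φ ^ 2 + ψ = β ^ 2 := (Real.sq_sqrt hb.le).symm
  have hχ := h.nonneg.1
  -- If `φ < β` any admissible `c` works, hence the arbitrary `- 1`; if `φ = β` it must lie between
  -- `α` and `1 - lam`.
  obtain ⟨c, hc, hc2⟩ : ∃ c, c < 1 / 2 - (lam - 1 / 2) ∧ (φ < β ∨ (φ = β ∧ α < c)) := by
    rcases hlt with hlt | ⟨h1, h2⟩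
    · exact ⟨1 / 2 - (lam - 1 / 2) - 1, by linarith, Or.inl hlt⟩
    · obtain ⟨c, hc1, hc2⟩ := exists_between h2
      exact ⟨c, by linarith, Or.inr ⟨h1, hc1⟩⟩
  have hσ : Tendsto (fun t : ℝ => Real.sqrt (t ^ 2 + χ)) atTop atTop :=
    Real.tendsto_sqrt_atTop.comp
      (tendsto_atTop_add_const_right _ _ (tendsto_pow_atTop two_ne_zero))
  have hinv : Tendsto (fun t : ℝ => t⁻¹) atTop (𝓝 0) := tendsto_inv_atTop_zero
  have hsmall : Tendsto (fun t : ℝ => α * χ * (t⁻¹ * t⁻¹) + φ * χ * t⁻¹) atTop (𝓝 0) := by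
    simpa using ((hinv.mul hinv).const_mul (α * χ)).add (hinv.const_mul (φ * χ))
  have hcomp : ∀ᶠ t in atTop, α + φ * t + (α * χ * (t⁻¹ * t⁻¹) + φ * χ * t⁻¹) < t * β + c := by
    rcases hc2 with hlt | ⟨h1, h2⟩
    · have h3 : Tendsto (fun t : ℝ => t * (β - φ)) atTop atTop :=
        tendsto_id.atTop_mul_const (sub_pos.2 hlt)
      filter_upwards [hsmall.eventually_lt_const one_pos, h3.eventually_gt_atTop (1 + α - c)]
        with t h4 h5
      linarith
    · filter_upwards [hsmall.eventually_lt_const (sub_pos.2 h2)] with t h4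
      rw [h1] at h4 ⊢
      linarith
  filter_upwards [hσ.eventually (eventually_le_gigIntegral_sub_one (lam - 1 / 2) hβ0 hc), hcomp,
    eventually_gt_atTop 0] with t h1 h2 ht
  have hs := h.sq_add_pos ht.ne'
  rw [Real.sq_sqrt hs.le, ← hβ2] at h1
  have hI := gigIntegral_pos (h.gigIntegrable φ) hs
  have hts : t ≤ Real.sqrt (t ^ 2 + χ) := Real.le_sqrt_of_sq_le (by linarith)
  -- Multiplying the criterion by `(t² + χ)/t` turns its right side into `σ² I_{p-1}` with `σ² = t²
  -- + χ`; the corrections due to `χ` tend to zero.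
  have h3 : (t ^ 2 + χ) / t * (α / t + φ) < Real.sqrt (t ^ 2 + χ) * β + c := by
    have e : (t ^ 2 + χ) / t * (α / t + φ)
        = α + φ * t + (α * χ * (t⁻¹ * t⁻¹) + φ * χ * t⁻¹) := by
      field_simp
    rw [e]
    nlinarith
  have h4 := (mul_lt_mul_of_pos_right h3 hI).trans_le h1
  have h5 : 0 < (t ^ 2 + χ) / t := by positivity
  refine lt_of_mul_lt_mul_left ?_ h5.le
  calc _ = (t ^ 2 + χ) / t * (α / t + φ) *
        gigIntegral (lam - 1 / 2) (φ ^ 2 + ψ) (t ^ 2 + χ) := by ring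
    _ < _ := h4
    _ = _ := by field_simp

lemma isRDecreasing_ghDensity_zero_iff {lam χ : ℝ} (h : GIGParameters lam χ 0) (α : ℝ) :
    IsRDecreasing α (ghDensity lam χ 0 0 1 0) ↔ α < 1 - 2 * lam := by
  obtain ⟨hl, hχ⟩ := h.neg_of_psi_eq_zero rfl
  have hb : (0 : ℝ) ^ 2 + 0 = 0 := by norm_num
  have hp : lam - 1 / 2 < 0 := by linarith
  constructor
  · rintro ⟨-, T, hT, hanti⟩
    by_contra! hα
    obtain ⟨D, hD, hDe⟩ := exists_ghDensity_eq h 0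
    have hI := gigIntegral_pos (Or.inr ⟨rfl, hp⟩ : GIGIntegrable (lam - 1 / 2) 0) one_pos
    -- When `α ≥ 1 - 2 lam`, both `t`-dependent factors are nondecreasing: the first exponent is
    -- nonnegative, and `1 + χ/t²` decreases under a negative power. Two points then contradict
    -- strict decrease.
    have heq : ∀ t, 0 < t → t ^ α * ghDensity lam χ 0 0 1 0 t =
        t ^ (α + 2 * (lam - 1 / 2)) * (1 + χ / t ^ 2) ^ (lam - 1 / 2) *
          (D * gigIntegral (lam - 1 / 2) 0 1) := by
      intro t ht
      have e : t ^ 2 + χ = t ^ 2 * (1 + χ / t ^ 2) := by field_simp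
      rw [hDe, hb, gigIntegral_zero_eq (h.sq_add_pos ht.ne'), e,
        Real.mul_rpow (by positivity) (by positivity), Real.rpow_add ht, Real.rpow_mul ht.le,
        Real.rpow_two, mul_zero, Real.exp_zero]
      ring
    have hlt := hanti (show T < T + 1 by linarith) (show T < T + 2 by linarith)
      (show T + 1 < T + 2 by linarith)
    simp only [heq (T + 1) (by linarith), heq (T + 2) (by linarith)] at hlt
    refine absurd hlt (not_lt.2 ?_)
    gcongr ?_ * ?_ * _
    · exact Real.rpow_le_rpow (by linarith) (by linarith) (by linarith)
    · refine Real.rpow_le_rpow_of_nonpos (by positivity) ?_ hp.le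
      gcongr
      linarith
  · intro hα
    refine isRDecreasing_ghDensity h ?_
    rw [hb]
    -- By `gigIntegral_zero_sub_one` the criterion reduces to `α (t² + χ) < (1 - 2 lam) t²`.
    have hlim : Tendsto (fun t : ℝ => (1 - 2 * lam - α) * t ^ 2) atTop atTop :=
      (tendsto_pow_atTop two_ne_zero).const_mul_atTop (sub_pos.2 hα)
    filter_upwards [hlim.eventually_gt_atTop (α * χ), eventually_gt_atTop 0] with t ht ht0
    have hs := h.sq_add_pos ht0.ne'
    have hI := gigIntegral_pos (Or.inr ⟨rfl, hp⟩ : GIGIntegrable (lam - 1 / 2) 0) hs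
    have hrec := gigIntegral_zero_sub_one hp hs
    have h5 : 0 < (t ^ 2 + χ) * t := by positivity
    refine lt_of_mul_lt_mul_left ?_ h5.le
    calc _ = α * (t ^ 2 + χ) * gigIntegral (lam - 1 / 2) 0 (t ^ 2 + χ) := by
          field_simp
          ring
      _ < (1 - 2 * lam) * t ^ 2 * gigIntegral (lam - 1 / 2) 0 (t ^ 2 + χ) :=
          mul_lt_mul_of_pos_right (by linarith) hI
      _ = t ^ 2 * (-2 * (lam - 1 / 2) * gigIntegral (lam - 1 / 2) 0 (t ^ 2 + χ)) := by ring
      _ = _ := by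
          rw [← hrec]
          ring

end

theorem mainTheorem3 {Ω : Type*} [MeasurableSpace Ω] (P : Measure Ω) [IsProbabilityMeasure P]
    (ξ : Ω → ℝ) (lam χ ψ φ : ℝ) (hpar : GIGParameters lam χ ψ)
    (hξ : HasLaw ξ (ghLaw lam χ ψ 0 1 φ) P) :
    P.map ξ = volume.withDensity (fun t => ENNReal.ofReal (ghDensity lam χ ψ 0 1 φ t)) ∧
    (0 < ψ → ∀ α : ℝ, IsRDecreasing α (ghDensity lam χ ψ 0 1 φ)) ∧
    (ψ = 0 → φ < 0 → ∀ α : ℝ, IsRDecreasing α (ghDensity lam χ ψ 0 1 φ)) ∧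
    (ψ = 0 → 0 < φ → ∀ α : ℝ, α < 1 - lam → IsRDecreasing α (ghDensity lam χ ψ 0 1 φ)) ∧
    (ψ = 0 → φ = 0 → ∀ α : ℝ,
      (IsRDecreasing α (ghDensity lam χ ψ 0 1 φ) ↔ α < 1 - 2 * lam)) := by
  refine ⟨hξ.map_eq.trans (ghLaw_eq_withDensity hpar φ), fun hψ α => ?_, fun hψ hφ α => ?_,
    fun hψ hφ α hα => ?_, fun hψ hφ α => ?_⟩
  · exact isRDecreasing_ghDensity_of_sqrt hpar (by positivity)
      (Or.inl (Real.lt_sqrt_of_sq_lt (by linarith)))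
  · have hpos : 0 < φ ^ 2 + ψ := by rw [hψ, add_zero]; exact sq_pos_of_neg hφ
    exact isRDecreasing_ghDensity_of_sqrt hpar hpos (Or.inl (hφ.trans (Real.sqrt_pos.2 hpos)))
  · refine isRDecreasing_ghDensity_of_sqrt hpar (by positivity) (Or.inr ⟨?_, hα⟩)
    rw [hψ, add_zero, Real.sqrt_sq hφ.le]
  · subst hψ hφ
    exact isRDecreasing_ghDensity_zero_iff hpar α
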